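/- For a non-constant complex polynomial $P$, let $\mathcal{L}_P=\{z\in\mathbb{C} : |P(z)|=1\}$ denote its lemniscate. Let $n_1,n_2$ be integers with $1\le n_1\le n_2$ and let $d=\gcd(n_1,n_2)$. Then there exist complex polynomials $P_1$ and $P_2$ with $\deg P_1=n_1$ and $\deg P_2=n_2$ such that $$\#(\mathcal{L}_{P_1}\cap\mathcal{L}_{P_2}) = n_1n_2+n_2+de,\qquad e=\begin{cases}0,&\text{if } n_1/d \text{ is odd},\\ 1,&\text{if } n_1/d\text{ is even}.\end{cases}$$ -/

import Mathlib

/-- The lemniscate `{z ∈ ℂ : |P(z)| = 1}` of a complex polynomial `P`. -/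
def lemniscate (P : Polynomial ℂ) : Set ℂ :=
  {z : ℂ | ‖P.eval z‖ = 1}

/-! Take P₁ = 2a zⁿ − 1 and P₂ = 2bc (z − 1)ᵐ − 1 with n = n₁, m = n₂, c = −i exp(iγ) and small a, b
> 0. Inversion turns |2aζ − 1| = 1 into Re(1/ζ) = a (plus the point ζ = 0), so the lemniscates
become Re(1/zⁿ) = a and Re(1/(c(z − 1)ᵐ)) = b, plus the points 0 and 1 respectively.

For b = 0 the second equation describes m lines through 1, of directions exp(−iψ) with ψ = (γ +
kπ)/m. On one line, parametrized by s in (0, π), the first equation reads sinⁿ s · cos(n(s − ψ)) = a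
sinⁿ ψ. The left side has n + 1 critical points with critical values of alternating sign, so for
small a there are n + 1 solutions if n is odd, and n + 2 or n if n is even, according to the sign of
cos(nψ) (`eventually_encard_sin_pow_mul_cos_eq`). It remains to choose γ so that cos(nψ) > 0 for the
right number of lines (`exists_phase_sum_eq`).

None of these solutions is critical along its line, so the crossings are transversal. As the first
lemniscate is compact, their number survives the passage to small b > 0
(`IsCompact.eventually_encard_fiber_eq`). -/

/-! ### Counting zeros of piecewise monotone functions -/

open Set in
theorem encard_zeros_Ioo_of_strictMonoOn {g : ℝ → ℝ} {a b : ℝ} (hab : a < b)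
    (hc : ContinuousOn g (Icc a b)) (hm : StrictMonoOn g (Icc a b)) :
    {s ∈ Ioo a b | g s = 0}.encard = if g a * g b < 0 then 1 else 0 := by
  have hlt : g a < g b := hm (left_mem_Icc.2 hab.le) (right_mem_Icc.2 hab.le) hab
  split_ifs with h
  · have h0 : g a < 0 ∧ 0 < g b := by
      rcases mul_neg_iff.1 h with h | h
      · exact absurd hlt (by linarith [h.1, h.2])
      · exact h
    obtain ⟨c, hc1, hc2⟩ := intermediate_value_Ioo hab.le hc h0
    rw [encard_eq_one]
    refine ⟨c, Set.ext fun x => ⟨fun hx => ?_, ?_⟩⟩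
    · exact hm.injOn (Ioo_subset_Icc_self hx.1) (Ioo_subset_Icc_self hc1) (hx.2.trans hc2.symm)
    · rintro rfl
      exact ⟨hc1, hc2⟩
  · rw [encard_eq_zero, eq_empty_iff_forall_notMem]
    rintro x ⟨hx, hx0⟩
    have h1 := hm (left_mem_Icc.2 hab.le) (Ioo_subset_Icc_self hx) hx.1
    have h2 := hm (Ioo_subset_Icc_self hx) (right_mem_Icc.2 hab.le) hx.2
    rw [hx0] at h1 h2
    exact h (mul_neg_of_neg_of_pos h1 h2)

open Set in
theorem encard_zeros_Ioo {g : ℝ → ℝ} {a b : ℝ} (hab : a < b) (hc : Continuous g)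
    (hm : StrictMonoOn g (Icc a b) ∨ StrictAntiOn g (Icc a b)) :
    {s ∈ Ioo a b | g s = 0}.encard = if g a * g b < 0 then 1 else 0 := by
  rcases hm with hm | hm
  · exact encard_zeros_Ioo_of_strictMonoOn hab hc.continuousOn hm
  · have := encard_zeros_Ioo_of_strictMonoOn (g := fun x => -g x) hab hc.neg.continuousOn
      (fun x hx y hy hxy => neg_lt_neg (hm hx hy hxy))
    simpa using this

open Set in
theorem encard_zeros_Ioo_add {g : ℝ → ℝ} {a b c : ℝ} (hab : a < b) (hbc : b < c) (hb : g b ≠ 0) :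
    {s ∈ Ioo a c | g s = 0}.encard =
      {s ∈ Ioo a b | g s = 0}.encard + {s ∈ Ioo b c | g s = 0}.encard := by
  rw [← encard_union_eq]
  · congr 1
    ext x
    simp only [mem_ofPred_eq, mem_Ioo, mem_union]
    constructor
    · rintro ⟨⟨h1, h2⟩, h3⟩
      rcases lt_trichotomy x b with h | h | h
      · exact Or.inl ⟨⟨h1, h⟩, h3⟩
      · exact absurd h3 (h ▸ hb)
      · exact Or.inr ⟨⟨h, h2⟩, h3⟩
    · rintro (⟨⟨h1, h2⟩, h3⟩ | ⟨⟨h1, h2⟩, h3⟩)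
      · exact ⟨⟨h1, h2.trans hbc⟩, h3⟩
      · exact ⟨⟨hab.trans h1, h2⟩, h3⟩
  · rw [Set.disjoint_left]
    rintro x ⟨h1, -⟩ ⟨h2, -⟩
    exact lt_asymm h1.2 h2.1

open Set in
theorem encard_zeros_Ioo_of_alternating {g : ℝ → ℝ} (hc : Continuous g) (p : ℕ → ℝ)
    (hp : StrictMono p) (N : ℕ)
    (hm : ∀ i < N, StrictMonoOn g (Icc (p i) (p (i + 1))) ∨ StrictAntiOn g (Icc (p i) (p (i + 1))))
    (hs : ∀ i < N, g (p i) * g (p (i + 1)) < 0) :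
    {s ∈ Ioo (p 0) (p N) | g s = 0}.encard = N := by
  induction N with
  | zero => simp
  | succ N ih =>
    have hN := hs N (Nat.lt_succ_self N)
    have h0 : g (p N) ≠ 0 := left_ne_zero_of_mul hN.ne
    rcases Nat.eq_zero_or_pos N with rfl | hpos
    · rw [encard_zeros_Ioo (hp (Nat.lt_succ_self 0)) hc (hm 0 (by simp)), if_pos hN]
      simp
    · rw [encard_zeros_Ioo_add (hp hpos) (hp (Nat.lt_succ_self N)) h0,
        ih (fun i hi => hm i (hi.trans (Nat.lt_succ_self N)))
          (fun i hi => hs i (hi.trans (Nat.lt_succ_self N))),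
        encard_zeros_Ioo (hp (Nat.lt_succ_self N)) hc (hm N (Nat.lt_succ_self N)), if_pos hN]
      simp

/-! ### The trigonometric equation on a single line -/

theorem neg_one_zpow_mul_sin_pos {k : ℤ} {y : ℝ} (h1 : k * Real.pi < y)
    (h2 : y < (k + 1) * Real.pi) : 0 < (-1) ^ k * Real.sin y := by
  have h : Real.sin (y - k * Real.pi) = (-1) ^ k * Real.sin y := Real.sin_sub_int_mul_pi y k
  rw [← h]
  exact Real.sin_pos_of_pos_of_lt_pi (by linarith) (by linarith)

/-- The subtraction formula merges both product-rule terms into one sine, so the critical points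
inside (0, π) are equally spaced, at (β + iπ)/(n + 1). -/
theorem hasDerivAt_sin_pow_mul_sin (n : ℕ) (β τ s : ℝ) :
    HasDerivAt (fun s => Real.sin s ^ n * Real.sin (β - n * s) - τ)
      (n * Real.sin s ^ (n - 1) * Real.sin (β - (n + 1) * s)) s := by
  have h1 : HasDerivAt (fun s => β - n * s) (-n : ℝ) s := by
    simpa using ((hasDerivAt_id s).const_mul (n : ℝ)).const_sub β
  have h2 := ((Real.hasDerivAt_sin s).pow n).mul h1.sin
  refine (h2.sub_const τ).congr_deriv ?_
  rcases n with _ | n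
  · simp
  · have : Real.sin (β - ((n + 1 : ℕ) + 1) * s) =
        Real.sin (β - (n + 1 : ℕ) * s) * Real.cos s - Real.cos (β - (n + 1 : ℕ) * s) * Real.sin s := by
      rw [← Real.sin_sub]; ring_nf
    simp only [Pi.pow_apply, this, Nat.add_sub_cancel]
    push_cast
    ring

open Set in
theorem strictMonoOn_or_strictAntiOn_sin_pow_mul_sin {n : ℕ} (hn : 1 ≤ n) (β τ : ℝ) {a b : ℝ}
    (ha : 0 ≤ a) (hb : b ≤ Real.pi) (k : ℤ)
    (h : ∀ x ∈ Ioo a b, k * Real.pi < (n + 1) * x - β ∧ (n + 1) * x - β < (k + 1) * Real.pi) :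
    StrictMonoOn (fun s => Real.sin s ^ n * Real.sin (β - n * s) - τ) (Icc a b) ∨
    StrictAntiOn (fun s => Real.sin s ^ n * Real.sin (β - n * s) - τ) (Icc a b) := by
  have hc : Continuous (fun s => Real.sin s ^ n * Real.sin (β - n * s) - τ) := by fun_prop
  have key : ∀ x ∈ Ioo a b, 0 < (n : ℝ) * Real.sin x ^ (n - 1) ∧
      0 < (-1) ^ k * Real.sin ((n + 1) * x - β) := fun x hx =>
    ⟨mul_pos (by exact_mod_cast hn) (pow_pos (Real.sin_pos_of_pos_of_lt_pi (ha.trans_lt hx.1)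
      (hx.2.trans_le hb)) _), neg_one_zpow_mul_sin_pos (h x hx).1 (h x hx).2⟩
  have hs : ∀ x, Real.sin (β - (n + 1) * x) = -Real.sin ((n + 1) * x - β) := fun x => by
    rw [← Real.sin_neg, neg_sub]
  rcases Int.even_or_odd k with hk | hk
  · right
    refine strictAntiOn_of_deriv_neg (convex_Icc a b) hc.continuousOn fun x hx => ?_
    rw [interior_Icc] at hx
    obtain ⟨h1, h2⟩ := key x hx
    rw [hk.neg_one_zpow, one_mul] at h2
    rw [(hasDerivAt_sin_pow_mul_sin n β τ x).deriv, hs]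
    exact mul_neg_of_pos_of_neg h1 (neg_lt_zero.2 h2)
  · left
    refine strictMonoOn_of_deriv_pos (convex_Icc a b) hc.continuousOn fun x hx => ?_
    rw [interior_Icc] at hx
    obtain ⟨h1, h2⟩ := key x hx
    rw [hk.neg_one_zpow, neg_one_mul] at h2
    rw [(hasDerivAt_sin_pow_mul_sin n β τ x).deriv, hs]
    exact mul_pos h1 h2

-- At the critical points pᵢ, 0 ≤ i ≤ n, the function equals (−1)ⁱ sinⁿ⁺¹ pᵢ − τ, and the bound on τ
-- keeps these signs alternating: one zero in each of the n inner gaps. At both endpoints 0 and π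
-- the value is −τ, so each outer gap adds a zero or not according to the sign of τ, respectively
-- (−1)ⁿ τ.
open Set in
theorem encard_sin_pow_mul_sin_eq {n : ℕ} (hn : 1 ≤ n) {β τ : ℝ} (hβ : β ∈ Ioo 0 Real.pi)
    (hsmall : ∀ i ≤ n, |τ| < Real.sin ((β + i * Real.pi) / (n + 1)) ^ (n + 1)) :
    {s ∈ Ioo 0 Real.pi | Real.sin s ^ n * Real.sin (β - n * s) - τ = 0}.encard =
      n + (if 0 < τ then 1 else 0) + (if 0 < (-1) ^ n * τ then 1 else 0) := by
  have hπ := Real.pi_pos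
  have hn1 : (0 : ℝ) < n + 1 := by positivity
  set g : ℝ → ℝ := fun s => Real.sin s ^ n * Real.sin (β - n * s) - τ with hg
  set p : ℕ → ℝ := fun i => (β + i * Real.pi) / (n + 1) with hp
  have hgc : Continuous g := by fun_prop
  have hpm : ∀ i, (n + 1) * p i = β + i * Real.pi := fun i => by simp only [hp]; field_simp
  have hp0 : 0 < p 0 := by
    have := hpm 0; simp only [Nat.cast_zero, zero_mul, add_zero] at this
    exact pos_of_mul_pos_right (this ▸ hβ.1) hn1.le
  have hpn : p n < Real.pi := by
    have := hpm n
    have h2 := hβ.2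
    exact lt_of_mul_lt_mul_left (by rw [this]; linarith) hn1.le
  have hmono : StrictMono p := strictMono_nat_of_lt_succ fun i => by
    have h1 := hpm i
    have h2 := hpm (i + 1)
    push_cast at h2
    exact lt_of_mul_lt_mul_left (by rw [h1, h2]; linarith) hn1.le
  have hgp : ∀ i, g (p i) = (-1) ^ i * Real.sin (p i) ^ (n + 1) - τ := fun i => by
    have : β - n * p i = p i - i * Real.pi := by linarith [hpm i]
    simp only [hg, this, Real.sin_sub_nat_mul_pi]
    ring
  have hsgn : ∀ i ≤ n, 0 < (-1) ^ i * g (p i) := fun i hi => by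
    have h1 := hsmall i hi
    have h2 : (-1 : ℝ) ^ i * (-1) ^ i = 1 := by rw [← mul_pow]; simp
    have h3 : (-1) ^ i * τ ≤ |τ| := by
      refine (le_abs_self _).trans (by simp [abs_mul])
    rw [hgp, mul_sub, ← mul_assoc, h2]
    linarith
  have hg0 : g 0 = -τ := by simp [hg, zero_pow (by omega : n ≠ 0)]
  have hgπ : g Real.pi = -τ := by simp [hg, zero_pow (by omega : n ≠ 0)]
  have hne : ∀ i ≤ n, g (p i) ≠ 0 := fun i hi => right_ne_zero_of_mul (hsgn i hi).ne'
  have hmid : {s ∈ Ioo (p 0) (p n) | g s = 0}.encard = n := by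
    refine encard_zeros_Ioo_of_alternating hgc p hmono n (fun i hi => ?_) (fun i hi => ?_)
    · refine strictMonoOn_or_strictAntiOn_sin_pow_mul_sin hn β τ
        (hp0.le.trans (hmono.monotone (Nat.zero_le i)))
        ((hmono.monotone (show i + 1 ≤ n from hi)).trans hpn.le) i fun x hx => ?_
      have h1 := mul_lt_mul_of_pos_left hx.1 hn1
      have h2 := mul_lt_mul_of_pos_left hx.2 hn1
      rw [hpm] at h1 h2
      push_cast at h1 h2 ⊢
      exact ⟨by linarith, by linarith⟩
    · have h1 := hsgn i hi.le
      have h2 := hsgn (i + 1) hi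
      have h3 : (-1 : ℝ) ^ i * (-1) ^ i = 1 := by rw [← mul_pow]; simp
      have h4 := mul_pos h1 h2
      have h5 : (-1) ^ i * g (p i) * ((-1) ^ (i + 1) * g (p (i + 1))) =
        ((-1 : ℝ) ^ i * (-1) ^ i) * -(g (p i) * g (p (i + 1))) := by ring
      rw [h5, h3] at h4
      linarith
  have hleft : {s ∈ Ioo 0 (p 0) | g s = 0}.encard = if 0 < τ then 1 else 0 := by
    rw [encard_zeros_Ioo hp0 hgc ?_]
    · have h1 := hsgn 0 (Nat.zero_le n)
      rw [pow_zero, one_mul] at h1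
      simp only [hg0, mul_neg_iff, h1, h1.not_gt, neg_pos, neg_neg_iff_pos, and_true, and_false,
        false_or]
    -- The index is −1 because (n + 1)x − β lies in (−π, 0) before the first critical point.
    · refine strictMonoOn_or_strictAntiOn_sin_pow_mul_sin hn β τ le_rfl
        ((hmono.monotone (Nat.zero_le n)).trans hpn.le) (-1) fun x hx => ?_
      have h1 := mul_lt_mul_of_pos_left hx.1 hn1
      have h2 := mul_lt_mul_of_pos_left hx.2 hn1
      have h3 := hβ.2
      rw [hpm] at h2
      push_cast at h1 h2 ⊢
      exact ⟨by linarith, by linarith⟩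
  have hright : {s ∈ Ioo (p n) Real.pi | g s = 0}.encard = if 0 < (-1) ^ n * τ then 1 else 0 := by
    rw [encard_zeros_Ioo hpn hgc ?_]
    · have h1 := hsgn n le_rfl
      have h3 : (-1 : ℝ) ^ n * (-1) ^ n = 1 := by rw [← mul_pow]; simp
      have h5 : g (p n) * g Real.pi = -(((-1) ^ n * g (p n)) * ((-1) ^ n * τ)) := by
        rw [hgπ]; linear_combination (-g (p n) * τ) * (-h3)
      rw [h5]
      simp only [neg_neg_iff_pos, mul_pos_iff_of_pos_left h1]
    · refine strictMonoOn_or_strictAntiOn_sin_pow_mul_sin hn β τ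
        (hp0.le.trans (hmono.monotone (Nat.zero_le n))) le_rfl n fun x hx => ?_
      have h1 := mul_lt_mul_of_pos_left hx.1 hn1
      have h2 := mul_lt_mul_of_pos_left hx.2 hn1
      have h3 := hβ.1
      rw [hpm] at h1
      push_cast at h1 h2 ⊢
      exact ⟨by linarith, by linarith⟩
  rw [encard_zeros_Ioo_add hp0 ((hmono.monotone (Nat.zero_le n)).trans_lt hpn) (hne 0 (Nat.zero_le n)),
    hleft]
  rcases Nat.eq_zero_or_pos n with h | h
  · omega
  · rw [encard_zeros_Ioo_add (hmono h) hpn (hne n le_rfl), hmid, hright]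
    ring

/-- Here β is nψ + π/2 reduced modulo π and σ is the resulting sign; cos(nψ) ≠ 0 is what rules out β
= 0. -/
theorem exists_cos_mul_sub_eq_sin {n : ℕ} {ψ : ℝ} (h : Real.cos (n * ψ) ≠ 0) :
    ∃ β ∈ Set.Ioo 0 Real.pi, ∃ σ : ℝ, |σ| = 1 ∧
      (∀ s, Real.cos (n * (s - ψ)) = σ * Real.sin (β - n * s)) ∧
      ∀ s, Real.cos ((n + 1) * s - n * ψ) = σ * Real.sin (β - (n + 1) * s) := by
  have hπ := Real.pi_pos
  set m : ℤ := ⌊(n * ψ + Real.pi / 2) / Real.pi⌋ with hm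
  have key : ∀ x, Real.cos (x - n * ψ) =
      (-1) ^ m * Real.sin (n * ψ + Real.pi / 2 - m * Real.pi - x) := fun x => by
    have h1 : Real.sin (n * ψ + Real.pi / 2 - m * Real.pi - x) =
        Real.cos ((x - n * ψ) + m * Real.pi) := by
      rw [← Real.cos_pi_div_two_sub]; ring_nf
    rw [h1, Real.cos_add_int_mul_pi, ← mul_assoc, ← zpow_add₀ (by norm_num), (Even.add_self m).neg_one_zpow, one_mul]
  refine ⟨n * ψ + Real.pi / 2 - m * Real.pi, ⟨?_, ?_⟩, (-1) ^ m, ?_, fun s => ?_, fun s => key _⟩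
  · have h1 : m * Real.pi ≤ n * ψ + Real.pi / 2 := (le_div_iff₀ hπ).1 (Int.floor_le _)
    refine lt_of_le_of_ne (by linarith) fun h0 => h ?_
    have := key 0
    rw [← h0] at this
    simpa using this
  · have h1 : n * ψ + Real.pi / 2 < (m + 1) * Real.pi := (div_lt_iff₀ hπ).1 (Int.lt_floor_add_one _)
    linarith
  · simp
  · rw [← key]; ring_nf

-- Since sin β > 0, the sign σ is that of cos(nψ); it decides whether, for even n, both outer gaps
-- contribute or neither does. The second clause is kept for the transversality argument.
open Set Filter Topology in
theorem eventually_encard_sin_pow_mul_cos_eq {n : ℕ} (hn : 1 ≤ n) {ψ : ℝ} (hψ : ψ ∈ Ioo 0 Real.pi)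
    (hcos : Real.cos (n * ψ) ≠ 0) :
    ∀ᶠ a in 𝓝[>] (0 : ℝ),
      {s ∈ Ioo 0 Real.pi | Real.sin s ^ n * Real.cos (n * (s - ψ)) = a * Real.sin ψ ^ n}.encard =
        ((if Even n then (if 0 < Real.cos (n * ψ) then n + 2 else n) else n + 1 : ℕ) : ℕ∞) ∧
      ∀ s ∈ Ioo 0 Real.pi, Real.sin s ^ n * Real.cos (n * (s - ψ)) = a * Real.sin ψ ^ n →
        Real.cos ((n + 1) * s - n * ψ) ≠ 0 := by
  have hπ := Real.pi_pos
  have hn1 : (0 : ℝ) < n + 1 := by positivity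
  obtain ⟨β, hβ, σ, hσ, h1, h2⟩ := exists_cos_mul_sub_eq_sin hcos
  have hσσ : σ * σ = 1 := by rw [← abs_mul_abs_self, hσ, one_mul]
  have hσ0 : σ ≠ 0 := by rintro rfl; simp at hσ
  have hψn : 0 < Real.sin ψ ^ n := pow_pos (Real.sin_pos_of_pos_of_lt_pi hψ.1 hψ.2) n
  have hsmall : ∀ᶠ a in 𝓝[>] (0 : ℝ), ∀ i ∈ Finset.range (n + 1),
      a * Real.sin ψ ^ n < Real.sin ((β + i * Real.pi) / (n + 1)) ^ (n + 1) := by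
    rw [Filter.eventually_all_finset]
    intro i hi
    have hi' : (i : ℝ) ≤ n := by exact_mod_cast Nat.lt_succ_iff.1 (Finset.mem_range.1 hi)
    have hpos : 0 < Real.sin ((β + i * Real.pi) / (n + 1)) ^ (n + 1) := by
      refine pow_pos (Real.sin_pos_of_pos_of_lt_pi ?_ ?_) _
      · exact div_pos (add_pos_of_pos_of_nonneg hβ.1 (by positivity)) hn1
      · rw [div_lt_iff₀ hn1]
        nlinarith [hβ.2]
    have ht : Tendsto (fun a : ℝ => a * Real.sin ψ ^ n) (𝓝[>] 0) (𝓝 0) := by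
      have : Continuous fun a : ℝ => a * Real.sin ψ ^ n := by fun_prop
      simpa using (this.tendsto 0).mono_left nhdsWithin_le_nhds
    exact ht.eventually_lt_const hpos
  filter_upwards [hsmall, self_mem_nhdsWithin] with a ha ha0
  have ha0 : 0 < a := ha0
  have hc0 : 0 < a * Real.sin ψ ^ n := mul_pos ha0 hψn
  have hiff : ∀ s, Real.sin s ^ n * Real.cos (n * (s - ψ)) = a * Real.sin ψ ^ n ↔
      Real.sin s ^ n * Real.sin (β - n * s) - σ * (a * Real.sin ψ ^ n) = 0 := fun s => by
    rw [h1]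
    constructor
    · intro h
      linear_combination σ * h - Real.sin s ^ n * Real.sin (β - n * s) * hσσ
    · intro h
      linear_combination σ * h + a * Real.sin ψ ^ n * hσσ
  have habs : |σ * (a * Real.sin ψ ^ n)| = a * Real.sin ψ ^ n := by
    rw [abs_mul, hσ, one_mul, abs_of_pos hc0]
  constructor
  · simp only [hiff]
    rw [encard_sin_pow_mul_sin_eq hn hβ fun i hi => by
      rw [habs]; exact ha i (Finset.mem_range.2 (Nat.lt_succ_of_le hi))]
    have hσβ : Real.cos (n * ψ) = σ * Real.sin β := by
      have := h1 0
      rw [zero_sub, mul_neg, Real.cos_neg] at this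
      simpa using this
    have hsβ := Real.sin_pos_of_pos_of_lt_pi hβ.1 hβ.2
    simp only [hσβ, mul_pos_iff_of_pos_right hsβ, ← mul_assoc, mul_pos_iff_of_pos_right hψn,
      mul_pos_iff_of_pos_right ha0]
    rcases eq_or_eq_neg_of_abs_eq hσ with rfl | rfl <;> rcases Nat.even_or_odd n with he | ho
    · simp [he, he.neg_one_pow, add_assoc, one_add_one_eq_two]
    · simp [ho.neg_one_pow, Nat.not_even_iff_odd.2 ho, not_lt.2 (zero_le_one' ℝ)]
    · simp [he, he.neg_one_pow, not_lt.2 (zero_le_one' ℝ)]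
    · simp [ho.neg_one_pow, Nat.not_even_iff_odd.2 ho, not_lt.2 (zero_le_one' ℝ)]
  -- A critical solution would be one of the points (β + iπ)/(n + 1), where the left side has
  -- modulus sinⁿ⁺¹ s, which exceeds a sinⁿ ψ.
  · intro s hs heq h0
    rw [h2, mul_eq_zero, or_iff_right hσ0, Real.sin_eq_zero_iff] at h0
    obtain ⟨k, hk⟩ := h0
    have hk1 : (-k : ℤ) > -1 := by
      have : (-1 : ℝ) * Real.pi < (-k : ℤ) * Real.pi := by
        push_cast
        nlinarith [mul_pos hn1 hs.1, hβ.2]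
      exact_mod_cast lt_of_mul_lt_mul_right this hπ.le
    have hk2 : (-k : ℤ) < n + 1 := by
      have : (-k : ℤ) * Real.pi < (n + 1 : ℤ) * Real.pi := by
        push_cast
        nlinarith [mul_lt_mul_of_pos_left hs.2 hn1, hβ.1]
      exact_mod_cast lt_of_mul_lt_mul_right this hπ.le
    obtain ⟨i, hi⟩ := Int.eq_ofNat_of_zero_le (show (0 : ℤ) ≤ -k by omega)
    have hki : (k : ℝ) = -i := by
      have : k = -(i : ℤ) := by omega
      rw [this]; push_cast; ring
    have hsi : s = (β + i * Real.pi) / (n + 1) := by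
      rw [eq_div_iff hn1.ne']
      rw [hki] at hk
      linarith
    have hlt := ha i (Finset.mem_range.2 (by omega))
    rw [← hsi] at hlt
    have hsp := Real.sin_pos_of_pos_of_lt_pi hs.1 hs.2
    have : β - n * s = s - i * Real.pi := by rw [hki] at hk; linarith
    rw [h1, this, Real.sin_sub_nat_mul_pi] at heq
    have h3 := congrArg abs heq
    rw [abs_of_pos hc0] at h3
    simp only [abs_mul, hσ, abs_pow, abs_neg, abs_one, one_pow, one_mul, abs_of_pos hsp] at h3
    rw [← h3, pow_succ] at hlt
    exact lt_irrefl _ hlt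

/-! ### Counting positive cosines and choosing the phase γ -/

open Real in
theorem cos_pos_of_mem_shifted {x : ℝ} (k : ℤ) (h1 : -(π / 2) < x - k * (2 * π)) (h2 : x - k * (2 * π) < π / 2) :
    0 < cos x := by
  rw [← Real.cos_sub_int_mul_two_pi x k]
  exact cos_pos_of_mem_Ioo ⟨h1, h2⟩

-- For odd N the number of equally spaced angles in the open right half-plane is (N ± 1)/2,
-- depending on the offset. The two offset windows, one per residue of N modulo 4, give the larger
-- value.
open Real Finset in
theorem card_filter_cos_arith_progression {N l : ℕ} {x : ℝ} (hx0 : 0 < x)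
    (h : N = 4 * l + 1 ∧ x * (4 * N) ≤ π ∨
      N = 4 * l + 3 ∧ π < x * N ∧ (x * N - π) * 4 ≤ π) :
    2 * #((range N).filter fun t : ℕ => 0 < cos (x + t * (2 * π / N))) = N + 1 := by
  have hπ := pi_pos
  have hN : 0 < N := by omega
  have hN' : (0 : ℝ) < N := by exact_mod_cast hN
  obtain ⟨u, hu⟩ : ∃ u, u = x * N := ⟨_, rfl⟩
  have hmul : ∀ t : ℕ, (x + t * (2 * π / N)) * N = u + t * (2 * π) := fun t => by
    rw [hu]; field_simp
  have pos : ∀ t : ℕ, ∀ k : ℤ, -(π / 2) * N < u + t * (2 * π) - k * (2 * π) * N →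
      u + t * (2 * π) - k * (2 * π) * N < π / 2 * N → 0 < cos (x + t * (2 * π / N)) :=
    fun t k h1 h2 => by
      refine cos_pos_of_mem_shifted k (lt_of_mul_lt_mul_right ?_ hN'.le)
        (lt_of_mul_lt_mul_right ?_ hN'.le)
      · rw [sub_mul, hmul]; exact h1
      · rw [sub_mul, hmul]; exact h2
  have neg : ∀ t : ℕ, π / 2 * N < u + t * (2 * π) → u + t * (2 * π) < (π + π / 2) * N →
      ¬ 0 < cos (x + t * (2 * π / N)) := fun t h1 h2 => by
    rw [not_lt]
    refine cos_nonpos_of_pi_div_two_le_of_le (le_of_mul_le_mul_right ?_ hN')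
      (le_of_mul_le_mul_right ?_ hN')
    · rw [hmul]; exact h1.le
    · rw [hmul]; exact h2.le
  have hu0 : 0 < u := by rw [hu]; positivity
  rcases h with ⟨rfl, h⟩ | ⟨rfl, h1, h2⟩
  · have hu1 : u * 4 ≤ π := by rw [hu]; linarith
    have : ((range (4 * l + 1)).filter fun t : ℕ => 0 < cos (x + t * (2 * π / (4 * l + 1 : ℕ)))) =
        range (l + 1) ∪ Ico (3 * l + 1) (4 * l + 1) := by
      ext t
      simp only [mem_filter, mem_union, mem_range, mem_Ico]
      constructor
      · rintro ⟨ht, hc⟩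
        by_contra hcon
        have ht1 : (l : ℝ) + 1 ≤ t := by exact_mod_cast (show l + 1 ≤ t by omega)
        have ht2 : (t : ℝ) ≤ 3 * l := by exact_mod_cast (show t ≤ 3 * l by omega)
        refine neg t ?_ ?_ hc
        · push_cast; nlinarith
        · push_cast; nlinarith
      · rintro (ht | ht)
        · refine ⟨by omega, pos t 0 ?_ ?_⟩
          · push_cast
            have : (0 : ℝ) ≤ t * (2 * π) := by positivity
            have : (0 : ℝ) ≤ l * π := by positivity
            nlinarith
          · have ht1 : (t : ℝ) ≤ l := by exact_mod_cast (show t ≤ l by omega)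
            push_cast; nlinarith
        · have ht1 : (t : ℝ) ≤ 4 * l := by exact_mod_cast (show t ≤ 4 * l by omega)
          have ht2 : (3 : ℝ) * l + 1 ≤ t := by exact_mod_cast ht.1
          have hl : (0 : ℝ) ≤ l * π := by positivity
          refine ⟨by omega, pos t 1 ?_ ?_⟩
          · push_cast; nlinarith
          · push_cast; nlinarith
    rw [this, card_union_of_disjoint]
    · simp only [card_range, Nat.card_Ico]; omega
    · rw [disjoint_left]; intro t; simp only [mem_range, mem_Ico]; omega
  · rw [← hu] at h1 h2
    have : ((range (4 * l + 3)).filter fun t : ℕ => 0 < cos (x + t * (2 * π / (4 * l + 3 : ℕ)))) =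
        range (l + 1) ∪ Ico (3 * l + 2) (4 * l + 3) := by
      ext t
      simp only [mem_filter, mem_union, mem_range, mem_Ico]
      constructor
      · rintro ⟨ht, hc⟩
        by_contra hcon
        have ht1 : (l : ℝ) + 1 ≤ t := by exact_mod_cast (show l + 1 ≤ t by omega)
        have ht2 : (t : ℝ) ≤ 3 * l + 1 := by exact_mod_cast (show t ≤ 3 * l + 1 by omega)
        refine neg t ?_ ?_ hc
        · push_cast; nlinarith
        · push_cast; nlinarith
      · rintro (ht | ht)
        · refine ⟨by omega, pos t 0 ?_ ?_⟩
          · push_cast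
            have : (0 : ℝ) ≤ t * (2 * π) := by positivity
            have : (0 : ℝ) ≤ l * π := by positivity
            nlinarith
          · have ht1 : (t : ℝ) ≤ l := by exact_mod_cast (show t ≤ l by omega)
            push_cast; nlinarith
        · have ht1 : (t : ℝ) ≤ 4 * l + 2 := by exact_mod_cast (show t ≤ 4 * l + 2 by omega)
          have ht2 : (3 : ℝ) * l + 2 ≤ t := by exact_mod_cast ht.1
          have hl : (0 : ℝ) ≤ l * π := by positivity
          refine ⟨by omega, pos t 1 ?_ ?_⟩
          · push_cast; nlinarith
          · push_cast; nlinarith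
    rw [this, card_union_of_disjoint]
    · simp only [card_range, Nat.card_Ico]; omega
    · rw [disjoint_left]; intro t; simp only [mem_range, mem_Ico]; omega

theorem Function.Periodic.card_filter_range_mul {N : ℕ} {p : ℕ → Prop} [DecidablePred p]
    (hp : Function.Periodic p N) (d : ℕ) :
    ((Finset.range (d * N)).filter p).card = d * ((Finset.range N).filter p).card := by
  induction d with
  | zero => simp
  | succ d ih =>
    have h := Nat.filter_Ico_card_eq_of_periodic (d * N) N p hp
    rw [Nat.count_eq_card_filter_range] at h
    rw [Nat.succ_mul, Nat.succ_mul, ← ih, ← h, Finset.range_eq_Ico, Finset.range_eq_Ico,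
      ← Finset.Ico_union_Ico_eq_Ico (Nat.zero_le (d * N)) (Nat.le_add_right _ N),
      Finset.filter_union, Finset.card_union_of_disjoint]
    exact Finset.disjoint_filter_filter (Finset.Ico_disjoint_Ico_consecutive _ _ _)

theorem Function.Periodic.card_filter_range_coprime_mul {N m : ℕ} (hN : 0 < N)
    (hm : Nat.Coprime m N) {p : ℕ → Prop} [DecidablePred p] (hp : Function.Periodic p N) :
    ((Finset.range N).filter fun k => p (m * k)).card = ((Finset.range N).filter p).card := by
  have hinj : Set.InjOn (fun k => m * k % N) (Finset.range N : Set ℕ) := fun x hx y hy hxy => by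
    have h : x ≡ y [MOD N] := Nat.ModEq.cancel_left_of_coprime (Nat.coprime_comm.1 hm) hxy
    simp only [Finset.coe_range, Set.mem_Iio] at hx hy
    rwa [Nat.ModEq, Nat.mod_eq_of_lt hx, Nat.mod_eq_of_lt hy] at h
  have himg : (Finset.range N).image (fun k => m * k % N) = Finset.range N := by
    refine Finset.eq_of_subset_of_card_le (fun x hx => ?_) ?_
    · obtain ⟨k, -, rfl⟩ := Finset.mem_image.1 hx
      exact Finset.mem_range.2 (Nat.mod_lt _ hN)
    · rw [Finset.card_image_of_injOn hinj]
  have hmod : ∀ k, p (m * k % N) = p (m * k) := fun k => hp.map_mod_nat _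
  conv_rhs => rw [← himg, Finset.filter_image, Finset.card_image_of_injOn
    (hinj.mono (Finset.coe_subset.2 (Finset.filter_subset _ _)))]
  simp only [hmod]

-- Shifting k by N adds Mπ to the angle, and M is odd, so the sign flips and exactly half of the
-- cosines are positive. Evenness of d makes dN a multiple of the period 2N.
open Real Finset in
theorem two_mul_card_filter_cos_pos_of_odd {n d N M : ℕ} (hM : Odd M) (hd : Even d) (hN : 0 < N)
    (hn : n = d * M) {c : ℝ} (hc : ∀ k : ℕ, cos ((c + n * (k * π)) / (d * N : ℕ)) ≠ 0) (hd0 : 0 < d) :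
    2 * #((range (d * N)).filter fun k : ℕ => 0 < cos ((c + n * (k * π)) / (d * N : ℕ))) = d * N := by
  have hN' : (N : ℝ) ≠ 0 := by exact_mod_cast hN.ne'
  have hd' : (d : ℝ) ≠ 0 := by exact_mod_cast hd0.ne'
  set p : ℕ → Prop := fun k => 0 < cos ((c + n * (k * π)) / (d * N : ℕ)) with hp
  have hshift : ∀ k, cos ((c + n * ((k + N : ℕ) * π)) / (d * N : ℕ)) =
      -cos ((c + n * (k * π)) / (d * N : ℕ)) := fun k => by
    have : (c + n * ((k + N : ℕ) * π)) / (d * N : ℕ) =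
        (c + n * (k * π)) / (d * N : ℕ) + M * π := by
      rw [hn]; push_cast; field_simp; ring
    rw [this, cos_add_nat_mul_pi, hM.neg_one_pow, neg_one_mul]
  have hnot : ∀ k, p (k + N) ↔ ¬ p k := fun k => by
    simp only [hp, hshift]
    have := hc k
    constructor
    · intro h; linarith
    · intro h; exact neg_pos.2 (lt_of_le_of_ne (not_lt.1 h) this)
  have hper : Function.Periodic p (d * N) := by
    have h2 : Function.Periodic p (2 * N) := fun k => by
      rw [two_mul, ← add_assoc]
      simp only [hnot, not_not]
    obtain ⟨e, rfl⟩ := hd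
    have := h2.nsmul e
    rwa [nsmul_eq_mul, Nat.cast_id, show e * (2 * N) = (e + e) * N by ring] at this
  have h1 := Nat.filter_Ico_card_eq_of_periodic N (d * N) p hper
  rw [Nat.count_eq_card_filter_range] at h1
  have h2 : (Ico N (N + d * N)).filter p = ((range (d * N)).filter fun k => ¬ p k).image (· + N) := by
    ext k
    simp only [mem_filter, mem_Ico, mem_image, mem_range]
    constructor
    · rintro ⟨⟨h1, h2⟩, h3⟩
      refine ⟨k - N, ⟨by omega, ?_⟩, by omega⟩
      rwa [← hnot, Nat.sub_add_cancel h1]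
    · rintro ⟨k, ⟨h1, h2⟩, rfl⟩
      exact ⟨⟨by omega, by omega⟩, (hnot k).2 h2⟩
  rw [h2, card_image_of_injective _ (add_left_injective N)] at h1
  have h3 := card_filter_add_card_filter_not (s := range (d * N)) p
  rw [card_range] at h3
  change 2 * #{k ∈ range (d * N) | p k} = d * N
  exact (two_mul _).trans ((congrArg (_ + ·) h1.symm).trans (by convert h3))

-- The angles are x + mk · 2π/N; multiplication by m permutes the residues modulo N, so each of the
-- d periods contributes (N + 1)/2. The choice of j makes xN equal to π/(4d) or π + π/(4d), as the
-- offset windows require.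
open Real Finset in
theorem two_mul_card_filter_cos_pos_of_even {n d N m l : ℕ} (hm : Nat.Coprime m N) (hd : 0 < d)
    (hn : n = d * (2 * m)) {j : ℕ} (h : N = 4 * l + 1 ∧ j = 0 ∨ N = 4 * l + 3 ∧ j = d) :
    2 * #((range (d * N)).filter fun k : ℕ => 0 < cos ((π / 4 + j * π + n * (k * π)) / (d * N : ℕ))) =
      d * N + d := by
  have hπ := pi_pos
  have hN : 0 < N := by omega
  have hN' : (0 : ℝ) < N := by exact_mod_cast hN
  have hd' : (1 : ℝ) ≤ d := by exact_mod_cast hd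
  have hd0 : (0 : ℝ) < d := by linarith
  set x : ℝ := (π / 4 + j * π) / (d * N : ℕ) with hx
  have hxN : x * N = (π / 4 + j * π) / d := by
    rw [hx]; push_cast; field_simp
  have hsmall : π / 4 / d ≤ π / 4 := div_le_self (by positivity) hd'
  have hsmall' : 0 < π / 4 / d := by positivity
  set p : ℕ → Prop := fun t => 0 < cos (x + t * (2 * π / N)) with hp
  have hper : Function.Periodic p N := fun t => by
    have : x + (t + N : ℕ) * (2 * π / N) = x + t * (2 * π / N) + 2 * π := by
      push_cast; field_simp; ring
    simp only [hp, this, cos_add_two_pi]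
  have hpm : Function.Periodic (fun k => p (m * k)) N := fun k => by
    have := (hper.nsmul m) (m * k)
    rw [nsmul_eq_mul, Nat.cast_id, ← mul_add] at this
    exact this
  have heq : ∀ k : ℕ, (π / 4 + j * π + n * (k * π)) / (d * N : ℕ) =
      x + (m * k : ℕ) * (2 * π / N) := fun k => by
    rw [hx, hn]; push_cast; field_simp
  have h1 : 2 * #{t ∈ range N | p t} = N + 1 := by
    refine card_filter_cos_arith_progression (l := l) (by positivity) ?_
    rcases h with ⟨h1, rfl⟩ | ⟨h1, rfl⟩
    · refine Or.inl ⟨h1, ?_⟩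
      rw [Nat.cast_zero, zero_mul, add_zero] at hxN
      linarith
    · have : x * N = π / 4 / j + π := by rw [hxN]; field_simp
      refine Or.inr ⟨h1, by linarith, by linarith⟩
  simp only [heq]
  have h2 := hpm.card_filter_range_mul d
  have h3 := hper.card_filter_range_coprime_mul hN hm
  change 2 * #{k ∈ range (d * N) | p (m * k)} = d * N + d
  rw [h2, h3, mul_left_comm, h1, mul_add, mul_one]

-- The phase is γ = (π/4 + jπ)/n₁. With M = n₁/d, three cases occur: for n₁ odd all lines contribute
-- equally, for n₁ even and M odd half of the cosines are positive, and for M even a surplus of d/2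
-- appears.
open Real Finset in
theorem exists_phase_sum_eq {n₁ n₂ : ℕ} (h₁ : 1 ≤ n₁) (h₂ : 1 ≤ n₂) :
    ∃ γ ∈ Set.Ioo 0 π, (∀ k : ℕ, cos (n₁ * ((γ + k * π) / n₂)) ≠ 0) ∧
      ∑ k ∈ range n₂, (if Even n₁ then (if 0 < cos (n₁ * ((γ + k * π) / n₂)) then n₁ + 2 else n₁)
        else n₁ + 1) =
      n₁ * n₂ + n₂ + Nat.gcd n₁ n₂ * (if Even (n₁ / Nat.gcd n₁ n₂) then 1 else 0) := by
  have hπ := pi_pos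
  have hn₁ : (0 : ℝ) < n₁ := by exact_mod_cast h₁
  have hn₂ : (0 : ℝ) < n₂ := by exact_mod_cast h₂
  have hmem : ∀ j : ℕ, j < n₁ → (π / 4 + j * π) / n₁ ∈ Set.Ioo 0 π := fun j hj => by
    have : (j : ℝ) + 1 ≤ n₁ := by exact_mod_cast hj
    refine ⟨by positivity, ?_⟩
    rw [div_lt_iff₀ hn₁]
    nlinarith
  have hang : ∀ j k : ℕ, n₁ * (((π / 4 + j * π) / n₁ + k * π) / n₂) =
      (π / 4 + j * π + n₁ * (k * π)) / n₂ := fun j k => by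
    field_simp
  have hne : ∀ j k : ℕ, cos ((π / 4 + j * π + n₁ * (k * π)) / n₂) ≠ 0 := fun j k h => by
    obtain ⟨i, hi⟩ := cos_eq_zero_iff.1 h
    rw [div_eq_iff hn₂.ne'] at hi
    have h3 : (1 + 4 * j + 4 * (n₁ * k) : ℝ) * π = (2 * ((2 * i + 1) * n₂)) * π := by linarith
    have h4 := mul_right_cancel₀ hπ.ne' h3
    have h5 : (1 + 4 * j + 4 * (n₁ * k) : ℤ) = 2 * ((2 * i + 1) * n₂) := by exact_mod_cast h4
    -- Parity: the left side is odd because of the summand π/4 in the phase, the right side is even.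
    omega
  obtain ⟨d, hd⟩ : ∃ d, d = Nat.gcd n₁ n₂ := ⟨_, rfl⟩
  have hd0 : 0 < d := hd ▸ Nat.gcd_pos_of_pos_left _ h₁
  obtain ⟨M, hM⟩ : d ∣ n₁ := hd ▸ Nat.gcd_dvd_left _ _
  obtain ⟨N, hN⟩ : d ∣ n₂ := hd ▸ Nat.gcd_dvd_right _ _
  have hcop : Nat.Coprime M N := by
    have := Nat.coprime_div_gcd_div_gcd (m := n₁) (n := n₂) (hd ▸ hd0)
    rwa [← hd, hM, hN, Nat.mul_div_cancel_left _ hd0, Nat.mul_div_cancel_left _ hd0] at this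
  have hdiv : n₁ / d = M := by rw [hM, Nat.mul_div_cancel_left _ hd0]
  have hN0 : 0 < N := Nat.pos_of_mul_pos_left (hN ▸ h₂)
  rw [← hd, hdiv]
  rcases Nat.even_or_odd n₁ with he | ho
  · have hsum : ∀ γ : ℝ, ∑ k ∈ range n₂, (if Even n₁ then
        (if 0 < cos (n₁ * ((γ + k * π) / n₂)) then n₁ + 2 else n₁) else n₁ + 1) =
        n₁ * n₂ + 2 * #((range n₂).filter fun k : ℕ => 0 < cos (n₁ * ((γ + k * π) / n₂))) := by
      intro γ
      have : ∀ k ∈ range n₂, (if Even n₁ then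
        (if 0 < cos (n₁ * ((γ + k * π) / n₂)) then n₁ + 2 else n₁) else n₁ + 1) =
          n₁ + 2 * (if 0 < cos (n₁ * ((γ + k * π) / n₂)) then 1 else 0) := fun k _ => by
        rw [if_pos he]; split_ifs <;> rfl
      rw [sum_congr rfl this, sum_add_distrib, ← mul_sum, card_filter, sum_const, card_range,
        smul_eq_mul, mul_comm n₂]
    rcases Nat.even_or_odd M with hMe | hMo
    · obtain ⟨m, hm⟩ := hMe
      rw [← two_mul] at hm
      have hNo : N % 2 = 1 := by
        rw [hm] at hcop
        exact Nat.odd_iff.1 (Nat.coprime_two_left.1 (Nat.Coprime.coprime_mul_right hcop))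
      have hcm : Nat.Coprime m N := by
        rw [hm] at hcop
        exact Nat.Coprime.coprime_mul_left hcop
      obtain ⟨j, l, hj, hjl⟩ : ∃ j l, j < n₁ ∧ (N = 4 * l + 1 ∧ j = 0 ∨ N = 4 * l + 3 ∧ j = d) := by
        rcases (by omega : N % 4 = 1 ∨ N % 4 = 3) with h | h
        · exact ⟨0, N / 4, h₁, Or.inl ⟨by omega, rfl⟩⟩
        · refine ⟨d, N / 4, ?_, Or.inr ⟨by omega, rfl⟩⟩
          -- M even and positive gives d < n₁, so that j = d still keeps γ below π.
          have : 2 ≤ M := by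
            rcases Nat.eq_zero_or_pos m with rfl | h
            · simp [hM, hm] at h₁
            · omega
          rw [hM]
          nlinarith
      refine ⟨_, hmem j hj, fun k => by rw [hang]; exact hne j k, ?_⟩
      rw [hsum, if_pos (by rw [hm]; exact even_two_mul m)]
      simp only [hang]
      have := two_mul_card_filter_cos_pos_of_even hcm hd0 (hm ▸ hM) hjl
      rw [← hN] at this
      rw [this]
      ring
    · have hde : Even d := by
        rw [hM, Nat.even_mul] at he
        exact he.resolve_right (Nat.not_even_iff_odd.2 hMo)
      refine ⟨_, hmem 0 h₁, fun k => by rw [hang]; exact hne 0 k, ?_⟩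
      rw [hsum, if_neg (Nat.not_even_iff_odd.2 hMo)]
      simp only [hang]
      have := two_mul_card_filter_cos_pos_of_odd hMo hde hN0 hM (c := π / 4 + (0 : ℕ) * π)
        (by rw [← hN]; exact hne 0) hd0
      rw [← hN] at this
      rw [this]
      ring
  · refine ⟨_, hmem 0 h₁, fun k => by rw [hang]; exact hne 0 k, ?_⟩
    have hMo : ¬ Even M := by
      rw [hM] at ho
      exact Nat.not_even_iff_odd.2 (Nat.odd_mul.1 ho).2
    rw [if_neg hMo]
    simp only [if_neg (Nat.not_even_iff_odd.2 ho), sum_const, card_range, smul_eq_mul]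
    ring

/-! ### Stability of the number of solutions -/

-- Off small neighbourhoods of the zeros, compactness keeps h away from values near 0; inside each
-- neighbourhood, `φ` supplies a point of the fiber over b and injectivity makes it the only one.
open Set Filter Topology in
theorem IsCompact.eventually_encard_fiber_eq {X : Type*} [TopologicalSpace X] [T2Space X]
    [Nonempty X] {K : Set X} (hK : IsCompact K) {h : X → ℝ} (hc : ContinuousOn h K)
    (hfin : {x ∈ K | h x = 0}.Finite)
    (hloc : ∀ x ∈ {x ∈ K | h x = 0}, ∃ U ∈ 𝓝 x, InjOn h (U ∩ K) ∧ ∃ φ : ℝ → X,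
      Tendsto φ (𝓝 0) (𝓝 x) ∧ ∀ᶠ b in 𝓝 0, φ b ∈ K ∧ h (φ b) = b) :
    ∀ᶠ b in 𝓝 0, {x ∈ K | h x = b}.encard = {x ∈ K | h x = 0}.encard := by
  set Z := {x ∈ K | h x = 0} with hZ
  choose! U hU hinj φ hφ hφK using hloc
  have hC : IsCompact (K \ ⋃ x ∈ Z, interior (U x)) :=
    hK.diff (isOpen_biUnion fun _ _ => isOpen_interior)
  have h0 : ∀ᶠ b in 𝓝 (0 : ℝ), b ∉ h '' (K \ ⋃ x ∈ Z, interior (U x)) := by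
    refine (hC.image_of_continuousOn (hc.mono sdiff_subset)).isClosed.isOpen_compl.mem_nhds ?_
    rintro ⟨x, ⟨hxK, hx⟩, hx0⟩
    exact hx (mem_biUnion (show x ∈ Z from ⟨hxK, hx0⟩)
      (mem_interior_iff_mem_nhds.2 (hU x ⟨hxK, hx0⟩)))
  have h1 : ∀ᶠ b in 𝓝 (0 : ℝ), ∀ x ∈ Z, φ x b ∈ K ∧ h (φ x b) = b :=
    (eventually_all_finite hfin).2 hφK
  have h2 : ∀ᶠ b in 𝓝 (0 : ℝ), ∀ x ∈ Z, φ x b ∈ U x :=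
    (eventually_all_finite hfin).2 fun x hx => hφ x hx (hU x hx)
  have h3 : ∀ᶠ b in 𝓝 (0 : ℝ), ∀ x ∈ Z, ∀ y ∈ Z, x ≠ y → φ x b ≠ φ y b := by
    refine (eventually_all_finite hfin).2 fun x hx => (eventually_all_finite hfin).2 fun y hy => ?_
    by_cases hxy : x = y
    · exact Eventually.of_forall fun b h => absurd hxy h
    · obtain ⟨u, v, hu, hv, huv⟩ := t2_separation_nhds hxy
      filter_upwards [hφ x hx hu, hφ y hy hv] with b hbu hbv _ heq
      exact disjoint_left.1 huv hbu (heq ▸ hbv)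
  filter_upwards [h0, h1, h2, h3] with b h0 h1 h2 h3
  have himg : {x ∈ K | h x = b} = (fun x => φ x b) '' Z := by
    ext y
    constructor
    · rintro ⟨hyK, hyb⟩
      by_contra hcon
      refine h0 ⟨y, ⟨hyK, fun hy => hcon ?_⟩, hyb⟩
      obtain ⟨x, hx, hyx⟩ := mem_iUnion₂.1 hy
      exact ⟨x, hx, hinj x hx ⟨h2 x hx, (h1 x hx).1⟩ ⟨interior_subset hyx, hyK⟩
        ((h1 x hx).2.trans hyb.symm)⟩
    · rintro ⟨x, hx, rfl⟩
      exact h1 x hx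
  rw [himg, InjOn.encard_image]
  intro x hx y hy hxy
  by_contra hne
  exact h3 x hx y hy hne hxy

-- The inverse function theorem for (Re f, Re g): ℂ → ℝ²; `hker` is injectivity of the real
-- derivative, which suffices by equality of dimensions.
open Set Filter Topology in
theorem HasStrictDerivAt.exists_local_inverse_re_prod_re {f g : ℂ → ℂ} {f' g' z : ℂ}
    (hf : HasStrictDerivAt f f' z) (hg : HasStrictDerivAt g g' z)
    (hker : ∀ v : ℂ, (f' * v).re = 0 → (g' * v).re = 0 → v = 0) :
    ∃ U ∈ 𝓝 z, InjOn (fun w => ((f w).re, (g w).re)) U ∧ ∃ φ : ℝ × ℝ → ℂ,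
      Tendsto φ (𝓝 ((f z).re, (g z).re)) (𝓝 z) ∧
      ∀ᶠ y in 𝓝 ((f z).re, (g z).re), ((f (φ y)).re, (g (φ y)).re) = y := by
  have h1 := Complex.reCLM.hasStrictFDerivAt.comp z (hf.hasStrictFDerivAt.restrictScalars ℝ)
  have h2 := Complex.reCLM.hasStrictFDerivAt.comp z (hg.hasStrictFDerivAt.restrictScalars ℝ)
  have h3 := h1.prodMk h2
  set L : ℂ →L[ℝ] ℝ × ℝ := _
  change HasStrictFDerivAt _ L z at h3
  have hL : Function.Injective L := by
    refine (injective_iff_map_eq_zero L).2 fun v hv => ?_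
    have hv1 := congrArg Prod.fst hv
    have hv2 := congrArg Prod.snd hv
    refine hker v ?_ ?_
    · rw [mul_comm]; simpa [L] using hv1
    · rw [mul_comm]; simpa [L] using hv2
  let e : ℂ ≃L[ℝ] ℝ × ℝ := (LinearMap.linearEquivOfInjective (L : ℂ →ₗ[ℝ] ℝ × ℝ) hL
    (by simp [Complex.finrank_real_complex])).toContinuousLinearEquiv
  have he : (e : ℂ →L[ℝ] ℝ × ℝ) = L := by
    ext v <;> rfl
  rw [← he] at h3
  refine ⟨_, (h3.toOpenPartialHomeomorph _).open_source.mem_nhds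
    h3.mem_toOpenPartialHomeomorph_source, (h3.toOpenPartialHomeomorph _).injOn, h3.localInverse _ _ _,
    h3.localInverse_tendsto, h3.eventually_right_inverse⟩

/-! ### Lines through 1 in angular coordinates -/

/-- The point of the line through `1` with direction `exp (-ψ I)` at which
`arg z = s - ψ`. -/
noncomputable def linePoint (ψ s : ℝ) : ℂ :=
  (Real.sin ψ / Real.sin s : ℝ) * Complex.exp ((s - ψ : ℝ) * Complex.I)

-- This is the law of sines in the triangle 0, 1, z.
open Complex in
theorem linePoint_sub_one {ψ s : ℝ} (hs : Real.sin s ≠ 0) :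
    linePoint ψ s - 1 = (-(Real.sin (s - ψ) / Real.sin s) : ℝ) * exp ((-ψ : ℝ) * I) := by
  have hψ : Real.sin ψ = Real.sin (s - (s - ψ)) := by ring_nf
  apply Complex.ext
  · rw [linePoint, sub_re, re_ofReal_mul, re_ofReal_mul, exp_ofReal_mul_I_re, exp_ofReal_mul_I_re,
      one_re, Real.cos_neg, Real.sin_sub, Real.cos_sub]
    field_simp
    linear_combination Real.sin s * Real.sin_sq_add_cos_sq ψ
  · rw [linePoint, sub_im, im_ofReal_mul, im_ofReal_mul, exp_ofReal_mul_I_im, exp_ofReal_mul_I_im,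
      one_im, Real.sin_neg]
    ring

open Complex in
theorem inv_ofReal_mul_exp_pow (r θ : ℝ) (n : ℕ) :
    (((r : ℂ) * exp (θ * I)) ^ n)⁻¹ = ((r⁻¹ ^ n : ℝ) : ℂ) * exp ((-(n * θ) : ℝ) * I) := by
  rw [mul_pow, ← exp_nat_mul, mul_inv, ← exp_neg]
  push_cast
  rw [inv_pow]
  ring_nf

theorem re_inv_linePoint_pow (ψ s : ℝ) (n : ℕ) :
    ((linePoint ψ s ^ n)⁻¹).re = (Real.sin s / Real.sin ψ) ^ n * Real.cos (n * (s - ψ)) := by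
  rw [linePoint, inv_ofReal_mul_exp_pow, Complex.re_ofReal_mul, Complex.exp_ofReal_mul_I_re,
    Real.cos_neg, inv_div]

theorem re_inv_linePoint_pow_eq_iff {ψ : ℝ} (hψ : Real.sin ψ ≠ 0) (s a : ℝ) (n : ℕ) :
    ((linePoint ψ s ^ n)⁻¹).re = a ↔
      Real.sin s ^ n * Real.cos (n * (s - ψ)) = a * Real.sin ψ ^ n := by
  rw [re_inv_linePoint_pow, div_pow, div_mul_eq_mul_div, div_eq_iff (pow_ne_zero n hψ)]

theorem Complex.re_inv_eq_zero_iff (z : ℂ) : (z⁻¹).re = 0 ↔ z.re = 0 := by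
  rw [Complex.inv_re, div_eq_zero_iff, Complex.normSq_eq_zero]
  constructor
  · rintro (h | rfl)
    · exact h
    · simp
  · exact Or.inl

open Complex in
theorem re_inv_rotated_pow_eq_zero_iff {γ ψ t : ℝ} {m : ℕ} (ht : t ≠ 0) :
    ((-I * exp (γ * I) * ((t : ℂ) * exp ((-ψ : ℝ) * I)) ^ m)⁻¹).re = 0 ↔
      Real.sin (γ - m * ψ) = 0 := by
  have h : -I * exp (γ * I) * ((t : ℂ) * exp ((-ψ : ℝ) * I)) ^ m =
      ((t ^ m : ℝ) : ℂ) * (-I * exp ((γ - m * ψ : ℝ) * I)) := by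
    have : ((γ - m * ψ : ℝ) : ℂ) * I = γ * I + m * ((-ψ : ℝ) * I) := by push_cast; ring
    rw [this, Complex.exp_add, Complex.exp_nat_mul, mul_pow]
    push_cast
    ring
  rw [Complex.re_inv_eq_zero_iff, h, re_ofReal_mul, mul_eq_zero, or_iff_right (pow_ne_zero m ht)]
  have : (-I * exp ((γ - m * ψ : ℝ) * I)).re = (exp ((γ - m * ψ : ℝ) * I)).im := by
    simp [mul_re]
  rw [this, exp_ofReal_mul_I_im]

theorem Complex.arg_mem_Ioo_of_im_pos {z : ℂ} (hz : 0 < z.im) : z.arg ∈ Set.Ioo 0 Real.pi := by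
  have h : 0 < Real.sin z.arg := by
    rw [Complex.sin_arg]
    exact div_pos hz (norm_pos_iff.2 fun h => by simp [h] at hz)
  constructor
  · by_contra hcon
    exact absurd h (not_lt.2 (Real.sin_nonpos_of_nonpos_of_neg_pi_le (not_lt.1 hcon)
      (Complex.neg_pi_lt_arg z).le))
  · refine lt_of_le_of_ne (Complex.arg_le_pi z) fun heq => ?_
    rw [heq, Real.sin_pi] at h
    exact lt_irrefl _ h

open Complex in
theorem Complex.exists_eq_ofReal_mul_exp_neg {w : ℂ} (hw : w.im ≠ 0) :
    ∃ ψ ∈ Set.Ioo 0 Real.pi, ∃ t : ℝ, w = t * exp ((-ψ : ℝ) * I) := by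
  have key : ∀ w : ℂ, w.im < 0 →
      ∃ ψ ∈ Set.Ioo 0 Real.pi, ∃ t : ℝ, w = t * exp ((-ψ : ℝ) * I) := fun w hw => by
    refine ⟨_, arg_mem_Ioo_of_im_pos (z := (starRingEnd ℂ) w) (by simpa using hw), ‖w‖, ?_⟩
    have h := congrArg (starRingEnd ℂ) (norm_mul_exp_arg_mul_I ((starRingEnd ℂ) w))
    rw [map_mul, ← exp_conj, map_mul, conj_ofReal, conj_ofReal, conj_I, conj_conj, norm_conj] at h
    conv_lhs => rw [← h]
    rw [ofReal_neg, neg_mul, mul_neg]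
  rcases lt_or_gt_of_ne hw with h | h
  · exact key w h
  · obtain ⟨ψ, hψ, t, ht⟩ := key (-w) (by simpa using h)
    refine ⟨ψ, hψ, -t, ?_⟩
    rw [ofReal_neg, neg_mul, ← ht, neg_neg]

-- Rotation by ψ makes the line horizontal at height sin ψ > 0; then s is the argument of the
-- rotated point.
open Complex in
theorem exists_eq_linePoint {z : ℂ} {ψ t : ℝ} (hψ : ψ ∈ Set.Ioo 0 Real.pi)
    (hz : z - 1 = t * exp ((-ψ : ℝ) * I)) :
    ∃ s ∈ Set.Ioo 0 Real.pi, z = linePoint ψ s := by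
  have hu : z * exp (ψ * I) = exp (ψ * I) + t := by
    have : exp ((-ψ : ℝ) * I) * exp (ψ * I) = 1 := by
      rw [← Complex.exp_add]; simp
    linear_combination exp (ψ * I) * hz + t * this
  have him : (z * exp (ψ * I)).im = Real.sin ψ := by
    rw [hu, add_im, ofReal_im, add_zero, exp_ofReal_mul_I_im]
  have hs := arg_mem_Ioo_of_im_pos (him.symm ▸ Real.sin_pos_of_pos_of_lt_pi hψ.1 hψ.2)
  refine ⟨_, hs, ?_⟩
  set s := (z * exp (ψ * I)).arg with hsdef
  have hs0 : Real.sin s ≠ 0 := (Real.sin_pos_of_pos_of_lt_pi hs.1 hs.2).ne'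
  have hpol := norm_mul_exp_arg_mul_I (z * exp (ψ * I))
  rw [← hsdef] at hpol
  have hR : Real.sin ψ / Real.sin s = ‖z * exp (ψ * I)‖ := by
    rw [div_eq_iff hs0, ← him]
    conv_lhs => rw [← hpol]
    rw [im_ofReal_mul, exp_ofReal_mul_I_im]
  rw [linePoint, hR]
  have : ((s - ψ : ℝ) : ℂ) * I = s * I + -(ψ * I) := by push_cast; ring
  rw [this, Complex.exp_add, ← mul_assoc, hpol, mul_assoc, ← Complex.exp_add]
  simp

theorem eq_of_sin_sub_eq_zero {x y : ℝ} (hx : x ∈ Set.Ioo 0 Real.pi) (hy : y ∈ Set.Ioo 0 Real.pi)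
    (h : Real.sin (x - y) = 0) : x = y := by
  have := (Real.sin_eq_zero_iff_of_lt_of_lt (by linarith [hx.1, hy.2]) (by linarith [hx.2, hy.1])).1 h
  linarith

open Complex in
theorem linePoint_injective {ψ ψ' s s' : ℝ} (hψ : ψ ∈ Set.Ioo 0 Real.pi)
    (hψ' : ψ' ∈ Set.Ioo 0 Real.pi) (hs : s ∈ Set.Ioo 0 Real.pi) (hs' : s' ∈ Set.Ioo 0 Real.pi)
    (h1 : linePoint ψ s ≠ 1) (h : linePoint ψ s = linePoint ψ' s') : ψ = ψ' ∧ s = s' := by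
  have hs0 : Real.sin s ≠ 0 := (Real.sin_pos_of_pos_of_lt_pi hs.1 hs.2).ne'
  have hs0' : Real.sin s' ≠ 0 := (Real.sin_pos_of_pos_of_lt_pi hs'.1 hs'.2).ne'
  have hψψ : ψ = ψ' := by
    have e : ((-(Real.sin (s - ψ) / Real.sin s) : ℝ) : ℂ) * exp ((-ψ : ℝ) * I) =
        (-(Real.sin (s' - ψ') / Real.sin s') : ℝ) * exp ((-ψ' : ℝ) * I) := by
      rw [← linePoint_sub_one hs0, ← linePoint_sub_one hs0', h]
    have e2 : ((-(Real.sin (s - ψ) / Real.sin s) : ℝ) : ℂ) * exp ((ψ' - ψ : ℝ) * I) =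
        (-(Real.sin (s' - ψ') / Real.sin s') : ℝ) := by
      have h2 : ((ψ' - ψ : ℝ) : ℂ) * I = (-ψ : ℝ) * I + ψ' * I := by push_cast; ring
      have h3 : exp ((-ψ' : ℝ) * I) * exp (ψ' * I) = 1 := by rw [← Complex.exp_add]; simp
      rw [h2, Complex.exp_add, ← mul_assoc, e, mul_assoc, h3, mul_one]
    have e3 := congrArg im e2
    rw [im_ofReal_mul, ofReal_im, exp_ofReal_mul_I_im, mul_eq_zero] at e3
    refine (eq_of_sin_sub_eq_zero hψ' hψ (e3.resolve_left fun h0 => h1 ?_)).symm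
    rw [← sub_eq_zero, linePoint_sub_one hs0, h0]
    simp
  subst hψψ
  refine ⟨rfl, eq_of_sin_sub_eq_zero hs hs' ?_⟩
  have hsψ := Real.sin_pos_of_pos_of_lt_pi hψ.1 hψ.2
  have e : ∀ s, linePoint ψ s * exp (ψ * I) = (Real.sin ψ / Real.sin s : ℝ) * exp (s * I) :=
    fun s => by
      have : (s : ℂ) * I = (s - ψ : ℝ) * I + ψ * I := by push_cast; ring
      rw [linePoint, this, Complex.exp_add, mul_assoc]
  have e2 : ((Real.sin ψ / Real.sin s : ℝ) : ℂ) * exp (s * I) =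
      (Real.sin ψ / Real.sin s' : ℝ) * exp (s' * I) := by rw [← e, ← e, h]
  have e3 := congrArg re e2
  rw [re_ofReal_mul, re_ofReal_mul, exp_ofReal_mul_I_re, exp_ofReal_mul_I_re] at e3
  rw [Real.sin_sub]
  field_simp at e3
  linarith

open Complex in
theorem setOf_re_inv_eq_iUnion_linePoint {n m : ℕ} (hm : 1 ≤ m) {γ a : ℝ}
    (hγ : γ ∈ Set.Ioo 0 Real.pi) (ha0 : 0 < a) (ha1 : a < 1) :
    {z : ℂ | ((z ^ n)⁻¹).re = a ∧ ((-I * exp (γ * I) * (z - 1) ^ m)⁻¹).re = 0} =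
      ⋃ k ∈ (Finset.range m : Set ℕ), linePoint ((γ + k * Real.pi) / m) ''
        {s ∈ Set.Ioo 0 Real.pi | Real.sin s ^ n * Real.cos (n * (s - (γ + k * Real.pi) / m)) =
          a * Real.sin ((γ + k * Real.pi) / m) ^ n} := by
  have hπ := Real.pi_pos
  have hm' : (0 : ℝ) < m := by exact_mod_cast hm
  ext z
  simp only [Set.mem_ofPred_eq, Set.mem_iUnion, Set.mem_image, Finset.coe_range, Set.mem_Iio]
  constructor
  · rintro ⟨h1, h2⟩
    -- Since 0⁻¹ = 0, the point z = 1 satisfies the second equation; the first excludes it because a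
    -- < 1.
    have hz1 : z - 1 ≠ 0 := fun h => by
      rw [sub_eq_zero.1 h] at h1
      simp at h1
      exact ha1.ne' h1
    have him : (z - 1).im ≠ 0 := fun h => by
      have hre : z - 1 = ((z - 1).re : ℂ) * exp ((-(0 : ℝ) : ℝ) * I) := by
        simp only [neg_zero, ofReal_zero, zero_mul, Complex.exp_zero, mul_one]
        exact Complex.ext rfl (by rw [h, ofReal_im])
      have ht : (z - 1).re ≠ 0 := fun h0 => hz1 (by rw [hre, h0]; simp)
      rw [hre, re_inv_rotated_pow_eq_zero_iff ht, mul_zero, sub_zero] at h2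
      exact (Real.sin_pos_of_pos_of_lt_pi hγ.1 hγ.2).ne' h2
    obtain ⟨ψ, hψ, t, ht⟩ := exists_eq_ofReal_mul_exp_neg him
    have ht0 : t ≠ 0 := by
      rintro rfl
      exact hz1 (by rw [ht]; simp)
    rw [ht, re_inv_rotated_pow_eq_zero_iff ht0, Real.sin_eq_zero_iff] at h2
    obtain ⟨i, hi⟩ := h2
    have h3 : (-i : ℤ) > -1 := by
      have : (-1 : ℝ) * Real.pi < (-i : ℤ) * Real.pi := by
        push_cast
        nlinarith [mul_pos hm' hψ.1, hγ.2]
      exact_mod_cast lt_of_mul_lt_mul_right this hπ.le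
    have h4 : (-i : ℤ) < m := by
      have : (-i : ℤ) * Real.pi < (m : ℤ) * Real.pi := by
        push_cast
        nlinarith [mul_lt_mul_of_pos_left hψ.2 hm', hγ.1]
      exact_mod_cast lt_of_mul_lt_mul_right this hπ.le
    obtain ⟨k, hk⟩ := Int.eq_ofNat_of_zero_le (show (0 : ℤ) ≤ -i by omega)
    have hik : (i : ℝ) = -k := by
      have : i = -(k : ℤ) := by omega
      rw [this]; push_cast; ring
    have hψk : ψ = (γ + k * Real.pi) / m := by
      rw [eq_div_iff hm'.ne']
      rw [hik] at hi
      linarith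
    obtain ⟨s, hs, rfl⟩ := exists_eq_linePoint hψ ht
    rw [re_inv_linePoint_pow_eq_iff (Real.sin_pos_of_pos_of_lt_pi hψ.1 hψ.2).ne'] at h1
    rw [hψk] at h1
    exact ⟨k, by omega, s, ⟨hs, h1⟩, by rw [hψk]⟩
  · rintro ⟨k, hk, s, ⟨hs, h1⟩, rfl⟩
    have hkm : (k : ℝ) + 1 ≤ m := by exact_mod_cast hk
    obtain ⟨ψ, hψdef⟩ : ∃ ψ, ψ = (γ + k * Real.pi) / m := ⟨_, rfl⟩
    rw [← hψdef] at h1 ⊢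
    have hψm : m * ψ = γ + k * Real.pi := by rw [hψdef]; field_simp
    have hψ : ψ ∈ Set.Ioo 0 Real.pi := by
      constructor
      · rw [hψdef]
        exact div_pos (add_pos_of_pos_of_nonneg hγ.1 (by positivity)) hm'
      · rw [hψdef, div_lt_iff₀ hm']
        nlinarith [hγ.2]
    have hsψ := Real.sin_pos_of_pos_of_lt_pi hψ.1 hψ.2
    rw [← re_inv_linePoint_pow_eq_iff hsψ.ne'] at h1
    refine ⟨h1, ?_⟩
    have hs0 : Real.sin s ≠ 0 := (Real.sin_pos_of_pos_of_lt_pi hs.1 hs.2).ne'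
    have hne : linePoint ψ s ≠ 1 := fun h => by
      rw [h] at h1
      simp at h1
      exact ha1.ne' h1
    have ht : -(Real.sin (s - ψ) / Real.sin s) ≠ 0 := fun h => hne (by
      rw [← sub_eq_zero, linePoint_sub_one hs0, h]; simp)
    rw [linePoint_sub_one hs0, re_inv_rotated_pow_eq_zero_iff ht, hψm, Real.sin_eq_zero_iff]
    exact ⟨-k, by push_cast; ring⟩

open Complex in
theorem hasStrictDerivAt_inv_const_mul_sub_pow {c p z : ℂ} (m : ℕ) (hc : c ≠ 0) (hz : z - p ≠ 0) :
    HasStrictDerivAt (fun w => (c * (w - p) ^ m)⁻¹)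
      (-(m * (c * (z - p) ^ m)⁻¹ / (z - p))) z := by
  have h0 : HasStrictDerivAt (fun w => w - p) 1 z := (hasStrictDerivAt_id z).sub_const p
  have h1 := (hasStrictDerivAt_inv (mul_ne_zero hc (pow_ne_zero m hz))).comp z
    ((h0.pow m).const_mul c)
  refine h1.congr_deriv ?_
  rcases m with _ | m
  · simp
  · simp only [Nat.add_sub_cancel]
    field_simp
    ring

-- Write v = q(z − 1). As g is nonzero and purely imaginary, the second condition makes q real, so v
-- points along the line. The first condition then says that q times a nonzero multiple of cos((n +
-- 1)s − nψ) vanishes.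
open Complex in
theorem derivative_kernel_trivial {n m : ℕ} (hn : 1 ≤ n) (hm : 1 ≤ m) {ψ s : ℝ} {c v : ℂ}
    (hc : c ≠ 0) (hψ : Real.sin ψ ≠ 0) (hs : Real.sin s ≠ 0) (hz1 : linePoint ψ s - 1 ≠ 0)
    (hz0 : linePoint ψ s ≠ 0)
    (hg : ((c * (linePoint ψ s - 1) ^ m)⁻¹).re = 0)
    (hcos : Real.cos ((n + 1) * s - n * ψ) ≠ 0)
    (h1 : (-(n * (linePoint ψ s ^ n)⁻¹ / linePoint ψ s) * v).re = 0)
    (h2 : (-(m * (c * (linePoint ψ s - 1) ^ m)⁻¹ / (linePoint ψ s - 1)) * v).re = 0) : v = 0 := by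
  have hn' : (n : ℝ) ≠ 0 := by exact_mod_cast (by omega : n ≠ 0)
  have hm' : (m : ℝ) ≠ 0 := by exact_mod_cast (by omega : m ≠ 0)
  obtain ⟨q, hq⟩ : ∃ q, q = v / (linePoint ψ s - 1) := ⟨_, rfl⟩
  have hv : v = q * (linePoint ψ s - 1) := by rw [hq, div_mul_cancel₀ _ hz1]
  obtain ⟨g, hgdef⟩ : ∃ g, g = (c * (linePoint ψ s - 1) ^ m)⁻¹ := ⟨_, rfl⟩
  have hg0 : g ≠ 0 := by
    rw [hgdef]
    exact inv_ne_zero (mul_ne_zero hc (pow_ne_zero m hz1))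
  rw [← hgdef] at hg h2
  have hgim : g.im ≠ 0 := fun h => hg0 (Complex.ext hg h)
  have hqim : q.im = 0 := by
    have e : -(m * g / (linePoint ψ s - 1)) * v = ((-m : ℝ) : ℂ) * (g * q) := by
      rw [hv]; push_cast; field_simp
    rw [e, re_ofReal_mul, mul_re, hg, zero_mul, zero_sub] at h2
    simpa [hm', hgim] using h2
  have hqre : q = (q.re : ℂ) := Complex.ext rfl (by rw [hqim, ofReal_im])
  have hquot : (linePoint ψ s - 1) / linePoint ψ s =
      (-(Real.sin (s - ψ) / Real.sin ψ) : ℝ) * exp ((-s : ℝ) * I) := by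
    rw [div_eq_iff hz0, linePoint_sub_one hs, linePoint]
    have : ((-ψ : ℝ) : ℂ) * I = (-s : ℝ) * I + (s - ψ : ℝ) * I := by push_cast; ring
    rw [this, Complex.exp_add]
    have h3 : (-(Real.sin (s - ψ) / Real.sin s)) =
      -(Real.sin (s - ψ) / Real.sin ψ) * (Real.sin ψ / Real.sin s) := by field_simp
    rw [h3, ofReal_mul]
    ring
  have hsin : Real.sin (s - ψ) ≠ 0 := fun h => hz1 (by rw [linePoint_sub_one hs, h]; simp)
  have hprod : (linePoint ψ s ^ n)⁻¹ * ((linePoint ψ s - 1) / linePoint ψ s) =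
      (((Real.sin s / Real.sin ψ) ^ n * -(Real.sin (s - ψ) / Real.sin ψ) : ℝ) : ℂ) *
        exp ((-((n + 1) * s - n * ψ) : ℝ) * I) := by
    rw [hquot]
    nth_rewrite 1 [linePoint]
    rw [inv_ofReal_mul_exp_pow, inv_div]
    have : ((-((n + 1) * s - n * ψ) : ℝ) : ℂ) * I =
        (-(n * (s - ψ)) : ℝ) * I + (-s : ℝ) * I := by push_cast; ring
    rw [this, Complex.exp_add]
    push_cast
    ring
  have e : -(n * (linePoint ψ s ^ n)⁻¹ / linePoint ψ s) * v = ((-n * q.re : ℝ) : ℂ) *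
      ((linePoint ψ s ^ n)⁻¹ * ((linePoint ψ s - 1) / linePoint ψ s)) := by
    rw [hv, hqre]; push_cast; rw [ofReal_re]; ring
  rw [e, hprod, re_ofReal_mul, re_ofReal_mul, exp_ofReal_mul_I_re, Real.cos_neg] at h1
  have hq0 : q.re = 0 := by
    simpa [hn', hcos, hs, hψ, hsin] using h1
  rw [hv, hqre, hq0]
  simp

/-! ### Lemniscates and the final construction -/

-- The circle |ζ − 1/(2a)| = 1/(2|a|) passes through 0, so inversion maps the rest of it to the line
-- Re = a.
open Complex in
theorem norm_two_mul_sub_one_eq_one_iff {a : ℝ} (ha : a ≠ 0) (ζ : ℂ) :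
    ‖(2 * a : ℝ) * ζ - 1‖ = 1 ↔ ζ = 0 ∨ (ζ⁻¹).re = a := by
  have h : ‖(2 * a : ℝ) * ζ - 1‖ = 1 ↔ a * normSq ζ = ζ.re := by
    rw [← sq_eq_sq₀ (norm_nonneg _) zero_le_one, ← normSq_eq_norm_sq, normSq_apply, normSq_apply,
      sub_re, sub_im, re_ofReal_mul, im_ofReal_mul, one_re, one_im]
    constructor
    · intro h
      have : (4 * a) * (a * (ζ.re * ζ.re + ζ.im * ζ.im)) = (4 * a) * ζ.re := by
        linear_combination h
      exact mul_left_cancel₀ (mul_ne_zero four_ne_zero ha) this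
    · intro h
      linear_combination (4 * a) * h
  rw [h]
  by_cases hζ : ζ = 0
  · simp [hζ]
  · rw [or_iff_right hζ, inv_re, div_eq_iff (normSq_pos.2 hζ).ne', eq_comm]

open Polynomial in
theorem isCompact_lemniscate {P : ℂ[X]} (hP : 0 < P.natDegree) : IsCompact (lemniscate P) := by
  have hc : Continuous fun z => ‖P.eval z‖ := P.continuous.norm
  have ht : Filter.Tendsto (fun z => ‖P.eval z‖) (Filter.cocompact ℂ) Filter.atTop :=
    P.tendsto_norm_atTop (natDegree_pos_iff_degree_pos.1 hP) tendsto_norm_cocompact_atTop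
  obtain ⟨K, hK, hKsub⟩ := Filter.mem_cocompact.1 (ht.eventually (Filter.eventually_gt_atTop 1))
  refine hK.of_isClosed_subset (isClosed_eq hc continuous_const) fun z hz => ?_
  by_contra hzK
  have : 1 < ‖P.eval z‖ := hKsub hzK
  exact this.ne' hz

open Polynomial Complex Filter Topology in
theorem exists_encard_lemniscate_inter {n m : ℕ} (hn : 1 ≤ n) (hm : 1 ≤ m) {γ : ℝ}
    (hγ : γ ∈ Set.Ioo 0 Real.pi) (hcos : ∀ k : ℕ, Real.cos (n * ((γ + k * Real.pi) / m)) ≠ 0) :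
    ∃ P₁ P₂ : ℂ[X], P₁.natDegree = n ∧ P₂.natDegree = m ∧
      (lemniscate P₁ ∩ lemniscate P₂).encard =
        ((∑ k ∈ Finset.range m, (if Even n then
          (if 0 < Real.cos (n * ((γ + k * Real.pi) / m)) then n + 2 else n) else n + 1) : ℕ) : ℕ∞) := by
  have hπ := Real.pi_pos
  have hm' : (0 : ℝ) < m := by exact_mod_cast hm
  have hn0 : n ≠ 0 := by omega
  have hψ : ∀ k ∈ Finset.range m, (γ + k * Real.pi) / m ∈ Set.Ioo 0 Real.pi := fun k hk => by
    have hkm : (k : ℝ) + 1 ≤ m := by exact_mod_cast Finset.mem_range.1 hk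
    constructor
    · exact div_pos (add_pos_of_pos_of_nonneg hγ.1 (by positivity)) hm'
    · rw [div_lt_iff₀ hm']
      nlinarith [hγ.2]
  have hev := (Filter.eventually_all_finset (Finset.range m)).2 fun k hk =>
    eventually_encard_sin_pow_mul_cos_eq hn (hψ k hk) (hcos k)
  obtain ⟨a, ha, ha0, ha1⟩ := (hev.and (Ioo_mem_nhdsGT (zero_lt_one' ℝ))).exists
  set c : ℂ := -I * exp (γ * I) with hc
  have hc0 : c ≠ 0 := mul_ne_zero (neg_ne_zero.2 I_ne_zero) (Complex.exp_ne_zero _)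
  set h : ℂ → ℝ := fun z => ((c * (z - 1) ^ m)⁻¹).re with hh
  have hT := setOf_re_inv_eq_iUnion_linePoint (n := n) hm hγ ha0 ha1
  rw [← hc] at hT
  have hne : ∀ k ∈ Finset.range m, ∀ s ∈ Set.Ioo 0 Real.pi,
      Real.sin s ^ n * Real.cos (n * (s - (γ + k * Real.pi) / m)) =
        a * Real.sin ((γ + k * Real.pi) / m) ^ n →
      linePoint ((γ + k * Real.pi) / m) s ≠ 1 := fun k hk s hs heq h1 => by
    rw [← re_inv_linePoint_pow_eq_iff
      (Real.sin_pos_of_pos_of_lt_pi (hψ k hk).1 (hψ k hk).2).ne', h1] at heq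
    simp at heq
    exact ha1.ne' heq
  have hcard : {z : ℂ | ((z ^ n)⁻¹).re = a ∧ h z = 0}.encard =
      ((∑ k ∈ Finset.range m, (if Even n then
        (if 0 < Real.cos (n * ((γ + k * Real.pi) / m)) then n + 2 else n) else n + 1) : ℕ) : ℕ∞) := by
    rw [hT, (Finset.finite_toSet _).encard_biUnion, finsum_mem_coe_finset, Nat.cast_sum]
    · refine Finset.sum_congr rfl fun k hk => ?_
      rw [Set.InjOn.encard_image, (ha k hk).1]
      rintro s ⟨hs, hs1⟩ s' ⟨hs', -⟩ heq
      exact (linePoint_injective (hψ k hk) (hψ k hk) hs hs' (hne k hk s hs hs1) heq).2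
    · intro k hk k' hk' hkk
      refine Set.disjoint_left.2 ?_
      rintro z ⟨s, ⟨hs, hs1⟩, rfl⟩ ⟨s', ⟨hs', -⟩, heq⟩
      have := (linePoint_injective (hψ k hk) (hψ k' hk') hs hs' (hne k hk s hs hs1) heq.symm).1
      rw [div_left_inj' hm'.ne', add_right_inj, mul_left_inj' hπ.ne'] at this
      exact hkk (by exact_mod_cast this)
  set P₁ : ℂ[X] := C ((2 * a : ℝ) : ℂ) * X ^ n - C 1 with hP₁
  have h2a : ((2 * a : ℝ) : ℂ) ≠ 0 := by exact_mod_cast (by positivity : 2 * a ≠ 0)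
  have hdeg₁ : P₁.natDegree = n := by rw [hP₁, natDegree_sub_C, natDegree_C_mul_X_pow _ _ h2a]
  have hL₁ : ∀ z, z ∈ lemniscate P₁ ↔ z = 0 ∨ ((z ^ n)⁻¹).re = a := fun z => by
    have : P₁.eval z = (2 * a : ℝ) * z ^ n - 1 := by simp [hP₁]
    change ‖P₁.eval z‖ = 1 ↔ _
    rw [this, norm_two_mul_sub_one_eq_one_iff ha0.ne', pow_eq_zero_iff hn0]
  have hK1 : ∀ z ∈ lemniscate P₁, z - 1 ≠ 0 := fun z hz h0 => by
    rw [hL₁, sub_eq_zero.1 h0] at hz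
    simp at hz
    exact ha1.ne' hz
  -- The point 0 lies on the first lemniscate without satisfying Re(1/zⁿ) = a; sin γ ≠ 0 keeps it
  -- off the m lines.
  have hh0 : h 0 ≠ 0 := fun h0 => by
    have : (0 : ℂ) - 1 = ((-1 : ℝ) : ℂ) * exp ((-(0 : ℝ) : ℝ) * I) := by simp
    simp only [hh, hc] at h0
    rw [this, re_inv_rotated_pow_eq_zero_iff (by norm_num), mul_zero, sub_zero] at h0
    exact (Real.sin_pos_of_pos_of_lt_pi hγ.1 hγ.2).ne' h0
  have hZ : {z ∈ lemniscate P₁ | h z = 0} = {z : ℂ | ((z ^ n)⁻¹).re = a ∧ h z = 0} := by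
    ext z
    simp only [Set.mem_ofPred_eq, hL₁]
    constructor
    · rintro ⟨rfl | h1, h2⟩
      · exact absurd h2 hh0
      · exact ⟨h1, h2⟩
    · exact fun h1 => ⟨Or.inr h1.1, h1.2⟩
  have hstable := (isCompact_lemniscate (hdeg₁.symm ▸ hn)).eventually_encard_fiber_eq (h := h)
    ?_ ?_ ?_
  · obtain ⟨b, hb, hb0⟩ := ((hstable.filter_mono (nhdsWithin_le_nhds (s := Set.Ioi 0))).and
      self_mem_nhdsWithin).exists
    have hb0 : 0 < b := hb0
    have h2b : ((2 * b : ℝ) : ℂ) * c ≠ 0 :=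
      mul_ne_zero (by exact_mod_cast (by positivity : 2 * b ≠ 0)) hc0
    refine ⟨P₁, C (((2 * b : ℝ) : ℂ) * c) * (X - C 1) ^ m - C 1, hdeg₁, ?_, ?_⟩
    · rw [natDegree_sub_C, natDegree_C_mul h2b, natDegree_pow, natDegree_X_sub_C, mul_one]
    · rw [← hcard, ← hZ, ← hb]
      congr 1
      ext z
      refine and_congr_right fun hz => ?_
      have : (C (((2 * b : ℝ) : ℂ) * c) * (X - C 1) ^ m - C 1).eval z =
          (2 * b : ℝ) * (c * (z - 1) ^ m) - 1 := by simp [mul_assoc]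
      change ‖_‖ = 1 ↔ _
      rw [this, norm_two_mul_sub_one_eq_one_iff hb0.ne',
        or_iff_right (mul_ne_zero hc0 (pow_ne_zero m (hK1 z hz)))]
  · intro z hz
    exact (Complex.continuous_re.continuousAt.comp
      (hasStrictDerivAt_inv_const_mul_sub_pow m hc0 (hK1 z hz)).hasDerivAt.continuousAt).continuousWithinAt
  · rw [hZ, ← Set.encard_lt_top_iff, hcard]
    exact ENat.natCast_lt_top _
  · intro z hz
    have hzK := hz.1
    rw [hZ] at hz
    obtain ⟨hza, hzh⟩ := hz
    have hzT : z ∈ {z : ℂ | ((z ^ n)⁻¹).re = a ∧ h z = 0} := ⟨hza, hzh⟩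
    rw [hT] at hzT
    simp only [Set.mem_iUnion] at hzT
    obtain ⟨k, hk, s, ⟨hs, hs1⟩, rfl⟩ := hzT
    have hk : k ∈ Finset.range m := hk
    set ψ := (γ + k * Real.pi) / m with hψdef
    have hz0 : linePoint ψ s ≠ 0 := fun h0 => by
      rw [h0, zero_pow hn0] at hza
      simp at hza
      exact ha0.ne hza
    have hz1 := hK1 _ hzK
    have hf : HasStrictDerivAt (fun w : ℂ => (w ^ n)⁻¹)
        (-(n * (linePoint ψ s ^ n)⁻¹ / linePoint ψ s)) (linePoint ψ s) := by
      simpa using hasStrictDerivAt_inv_const_mul_sub_pow (c := 1) (p := 0) n one_ne_zero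
        (by simpa using hz0)
    obtain ⟨U, hU, hinj, φ, hφ, hφ'⟩ := hf.exists_local_inverse_re_prod_re
      (hasStrictDerivAt_inv_const_mul_sub_pow m hc0 hz1) fun v h1 h2 =>
        derivative_kernel_trivial hn hm hc0
          (Real.sin_pos_of_pos_of_lt_pi (hψ k hk).1 (hψ k hk).2).ne'
          (Real.sin_pos_of_pos_of_lt_pi hs.1 hs.2).ne' hz1 hz0 hzh ((ha k hk).2 s hs hs1) h1 h2
    change ((c * (linePoint ψ s - 1) ^ m)⁻¹).re = 0 at hzh
    rw [hza, hzh] at hφ hφ'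
    have hpair : Tendsto (fun b : ℝ => (a, b)) (𝓝 0) (𝓝 (a, 0)) :=
      (Continuous.prodMk_right a).tendsto 0
    -- With 0 removed, Re(1/zⁿ) is constantly a on the lemniscate, so injectivity of the pair
    -- becomes injectivity of `h` alone.
    refine ⟨U ∩ {0}ᶜ, inter_mem hU (isOpen_compl_singleton.mem_nhds hz0), ?_,
      fun b => φ (a, b), hφ.comp hpair, ?_⟩
    · rintro x ⟨⟨hxU, hx0⟩, hxK⟩ y ⟨⟨hyU, hy0⟩, hyK⟩ hxy
      refine hinj hxU hyU (Prod.ext ?_ hxy)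
      exact (((hL₁ x).1 hxK).resolve_left hx0).trans (((hL₁ y).1 hyK).resolve_left hy0).symm
    · filter_upwards [hpair.eventually hφ'] with b hb
      exact ⟨(hL₁ _).2 (Or.inr (congrArg Prod.fst hb)), congrArg Prod.snd hb⟩

theorem proposition3 (n₁ n₂ : ℕ) (h₁ : 1 ≤ n₁) (h₁₂ : n₁ ≤ n₂) :
    ∃ P₁ P₂ : Polynomial ℂ, P₁.natDegree = n₁ ∧ P₂.natDegree = n₂ ∧
      (lemniscate P₁ ∩ lemniscate P₂).encard =
        ((n₁ * n₂ + n₂ +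
          Nat.gcd n₁ n₂ * (if Even (n₁ / Nat.gcd n₁ n₂) then 1 else 0) : ℕ) : ℕ∞) := by
  obtain ⟨γ, hγ, hcos, hsum⟩ := exists_phase_sum_eq h₁ (h₁.trans h₁₂)
  obtain ⟨P₁, P₂, hP₁, hP₂, h⟩ := exists_encard_lemniscate_inter h₁ (h₁.trans h₁₂) hγ hcos
  exact ⟨P₁, P₂, hP₁, hP₂, by rw [h, hsum]⟩
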